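/- Let $\beta\in\{1,2\}$. Let $m_N^\beta$ be the Haar probability measure on the orthogonal group $\mathcal O_N$ if $\beta=1$ and on the unitary group $\mathcal U_N$ if $\beta=2$. For a real symmetric ($\beta=1$) or complex Hermitian ($\beta=2$) $N\times N$ matrix $B$, let $$I_N^\beta(\theta,B)=\int e^{N\theta (UBU^*)_{11}}\,dm_N^\beta(U),$$ let $\lambda_1(B)\ge\dots\ge\lambda_N(B)$ be its eigenvalues, let $\|B\|_\infty$ be its operator norm and let $\hat\nu_B=\frac1N\sum_{i=2}^N\delta_{\lambda_i(B)}$. For finite measures $\mu,\nu$ on $\mathbb R$ let $$d(\mu,\nu)=\sup\Big\{\Big|\int f\,d\mu-\int f\,d\nu\Big| : |f(x)|\le 1 \text{ and } \Big|\frac{f(x)-f(y)}{x-y}\Big|\le 1 \text{ for all } x\ne y\Big\}.$$ For every $\theta>0$ and every $\kappa\in(0,1/2)$ there is a function $g_\kappa:\mathbb R_+\to\mathbb R_+$ (which may depend on $\theta$ and $\beta$) with $g_\kappa(\delta)\to0$ as $\delta\to0$, such that for every $M$ and every $\delta>0$ there is an $N_0$ such that for every $N\ge N_0$, $N\ge 1$,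 and all real symmetric (if $\beta=1$) or complex Hermitian (if $\beta=2$) $N\times N$ matrices $B_N,B_N'$ with $\|B_N\|_\infty\le M$, $\|B_N'\|_\infty\le M$, $d(\hat\nu_{B_N},\hat\nu_{B_N'})\le N^{-\kappa}$ and $|\lambda_1(B_N)-\lambda_1(B_N')|\le\delta$, $$\left|\frac1N\log I_N^\beta(\theta,B_N)-\frac1N\log I_N^\beta(\theta,B_N')\right|\le g_\kappa(\delta).$$ -/

import Mathlib

open MeasureTheory Filter Topology
open scoped NNReal ENNReal

namespace RankOneSpherical

section Group

variable (𝕜 : Type*) [RCLike 𝕜] (N : ℕ)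

/-- The Borel σ-algebra on `O_N` (`𝕜 = ℝ`) or `U_N` (`𝕜 = ℂ`). -/
instance instMeasurableSpaceUnitaryGroup : MeasurableSpace (Matrix.unitaryGroup (Fin N) 𝕜) :=
  borel _

instance instBorelSpaceUnitaryGroup : BorelSpace (Matrix.unitaryGroup (Fin N) 𝕜) :=
  ⟨rfl⟩

instance instCompactSpaceUnitaryGroup : CompactSpace (Matrix.unitaryGroup (Fin N) 𝕜) := by
  apply isCompact_iff_compactSpace.mp
  have hK : IsCompact (Set.pi Set.univ fun _ : Fin N => Set.pi Set.univ fun _ : Fin N =>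
      Metric.closedBall (0 : 𝕜) 1) :=
    isCompact_univ_pi fun _ => isCompact_univ_pi fun _ => isCompact_closedBall _ _
  have hc : IsClosed (Matrix.unitaryGroup (Fin N) 𝕜 : Set (Matrix (Fin N) (Fin N) 𝕜)) := by
    have h : (Matrix.unitaryGroup (Fin N) 𝕜 : Set (Matrix (Fin N) (Fin N) 𝕜)) =
        {U | U * star U = 1} := by
      ext U
      exact Matrix.mem_unitaryGroup_iff
    rw [h]
    exact isClosed_eq (by fun_prop) continuous_const
  refine hK.of_isClosed_subset hc fun U hU => ?_
  simp only [Set.mem_pi, Set.mem_univ, true_imp_iff, mem_closedBall_zero_iff]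
  exact fun i j => entry_norm_bound_of_unitary hU i j

/-- The Haar probability measure on `O_N` (`𝕜 = ℝ`) or `U_N` (`𝕜 = ℂ`): the Haar measure that
gives mass one to the whole (compact) group. -/
noncomputable def haarProb : Measure (Matrix.unitaryGroup (Fin N) 𝕜) :=
  Measure.haarMeasure ⊤

end Group

variable {𝕜 : Type*} [RCLike 𝕜] {N : ℕ}

/-- The rank one spherical integral `∫ exp (N θ (U B U*)₁₁) dm(U)`. The first coordinate has index
`0`; for Hermitian `B` the entry `(U B U*)₁₁` is real, and `RCLike.re` only changes its type. -/
noncomputable def sphericalIntegral [NeZero N] (θ : ℝ) (B : Matrix (Fin N) (Fin N) 𝕜) : ℝ :=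
  ∫ U : Matrix.unitaryGroup (Fin N) 𝕜,
    Real.exp (N * θ * RCLike.re
      (((U : Matrix (Fin N) (Fin N) 𝕜) * B * (U : Matrix (Fin N) (Fin N) 𝕜).conjTranspose) 0 0))
    ∂(haarProb 𝕜 N)

/-- The eigenvalues of a Hermitian matrix, with multiplicity, in decreasing order; the largest one
has index `0`. -/
noncomputable def eig {B : Matrix (Fin N) (Fin N) 𝕜} (hB : B.IsHermitian) (i : Fin N) : ℝ :=
  hB.eigenvalues₀ (Fin.cast (Fintype.card_fin N).symm i)

/-- The spectral measure without the largest eigenvalue, `(1/N) ∑_{i ≥ 2} δ_{λᵢ}`. -/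
noncomputable def truncSpectralMeasure [NeZero N] {B : Matrix (Fin N) (Fin N) 𝕜}
    (hB : B.IsHermitian) : Measure ℝ :=
  (N : ℝ≥0∞)⁻¹ • ∑ i ∈ Finset.univ.erase (0 : Fin N), Measure.dirac (eig hB i)

/-- The Dudley distance: the supremum of `|∫ f dμ - ∫ f dν|` over the functions `f` with
`|f| ≤ 1` that are Lipschitz with constant one. -/
noncomputable def dudleyDist (μ ν : Measure ℝ) : ℝ≥0∞ :=
  ⨆ (f : ℝ → ℝ) (_ : (∀ x, |f x| ≤ 1) ∧ LipschitzWith 1 f),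
    ENNReal.ofReal |∫ x, f x ∂μ - ∫ x, f x ∂ν|

end RankOneSpherical

namespace RankOneSpherical

variable {𝕜 : Type*} [RCLike 𝕜] {N : ℕ}

/-! By invariance of Haar measure the integral depends only on the eigenvalues, through the weight
`exp (N θ ∑ₖ λₖ |U₀ₖ|²)`. Two estimates carry the proof.

Changing all eigenvalues by at most `δ` changes `(1/N) log I` by at most `θ δ`, since the row `U₀`
has norm one (`diagIntegral_le_exp_mul`).

Raising a single `λᵢ` to the top value costs only a factor polynomial in `N`
(`diagIntegral_update_le`): a rotation in the plane of the coordinates `0` and `i` can move the mass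
`|U₀ᵢ|²` onto the coordinate `0`, where it already has the top weight. The rotation depends on `U`,
but polynomially many rotations approximate all of them well enough, and Haar measure is invariant
under each.

Closeness in the Dudley distance bounds the `ℓ¹` distance of the ordered eigenvalues
(`sum_abs_eig_sub_le`), so only `O(N^(1-κ)/δ)` of them differ by more than `δ`. Raising these costs
`O(N^(-κ) log N / δ)` in `(1/N) log I`, which tends to zero; the others and the top one differ by at
most `δ`. -/

instance instIsHaarMeasureHaarProb : (haarProb 𝕜 N).IsHaarMeasure := by
  unfold haarProb; infer_instance

instance instIsProbabilityMeasureHaarProb : IsProbabilityMeasure (haarProb 𝕜 N) :=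
  ⟨Measure.haarMeasure_self⟩

/-- Permutations, eigenvector matrices and rotations all act on the row `U₀` from the right, so
right invariance is what is needed. It follows from uniqueness of the Haar probability measure. -/
instance instIsMulRightInvariantHaarProb : (haarProb 𝕜 N).IsMulRightInvariant where
  map_mul_right_eq_self g := by
    have : IsProbabilityMeasure (Measure.map (· * g) (haarProb 𝕜 N)) :=
      Measure.isProbabilityMeasure_map (measurable_mul_const g).aemeasurable
    exact Measure.isHaarMeasure_eq_of_isProbabilityMeasure _ _

/-! ### Reduction to diagonal matrices and ordered eigenvalues -/

/-- The exponential weight `exp (N θ ∑ₖ lamₖ |U₀ₖ|²)`. -/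
noncomputable def diagWeight [NeZero N] (θ : ℝ) (lam : Fin N → ℝ)
    (U : Matrix.unitaryGroup (Fin N) 𝕜) : ℝ :=
  Real.exp (N * θ * ∑ k, lam k * ‖(U : Matrix (Fin N) (Fin N) 𝕜) 0 k‖ ^ 2)

variable (𝕜) in
/-- The spherical integral of a diagonal matrix. -/
noncomputable def diagIntegral [NeZero N] (θ : ℝ) (lam : Fin N → ℝ) : ℝ :=
  ∫ U : Matrix.unitaryGroup (Fin N) 𝕜, diagWeight θ lam U ∂(haarProb 𝕜 N)

lemma continuous_diagWeight [NeZero N] (θ : ℝ) (lam : Fin N → ℝ) :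
    Continuous (diagWeight (𝕜 := 𝕜) θ lam) := by
  unfold diagWeight
  have h : ∀ k, Continuous fun U : Matrix.unitaryGroup (Fin N) 𝕜 =>
      (U : Matrix (Fin N) (Fin N) 𝕜) 0 k := fun k =>
    (continuous_apply k).comp ((continuous_apply (0 : Fin N)).comp continuous_subtype_val)
  exact Real.continuous_exp.comp (continuous_const.mul
    (continuous_finsetSum _ fun k _ => continuous_const.mul ((h k).norm.pow 2)))

lemma integrable_of_continuous {f : Matrix.unitaryGroup (Fin N) 𝕜 → ℝ} (hf : Continuous f) :
    Integrable f (haarProb 𝕜 N) :=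
  hf.integrable_of_hasCompactSupport (HasCompactSupport.of_compactSpace f)

lemma integrable_diagWeight_mul [NeZero N] (θ : ℝ) (lam : Fin N → ℝ)
    (V : Matrix.unitaryGroup (Fin N) 𝕜) :
    Integrable (fun U => diagWeight θ lam (U * V)) (haarProb 𝕜 N) :=
  integrable_of_continuous ((continuous_diagWeight θ lam).comp (continuous_mul_const V))

lemma integrable_diagWeight [NeZero N] (θ : ℝ) (lam : Fin N → ℝ) :
    Integrable (diagWeight (𝕜 := 𝕜) θ lam) (haarProb 𝕜 N) :=
  integrable_of_continuous (continuous_diagWeight θ lam)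

lemma diagIntegral_pos [NeZero N] (θ : ℝ) (lam : Fin N → ℝ) : 0 < diagIntegral 𝕜 θ lam :=
  integral_exp_pos (integrable_diagWeight θ lam)

lemma integral_diagWeight_mul [NeZero N] (θ : ℝ) (lam : Fin N → ℝ)
    (V : Matrix.unitaryGroup (Fin N) 𝕜) :
    ∫ U, diagWeight θ lam (U * V) ∂(haarProb 𝕜 N) = diagIntegral 𝕜 θ lam :=
  integral_mul_right_eq_self (diagWeight θ lam) V

lemma row_norm_sq_sum (U : Matrix.unitaryGroup (Fin N) 𝕜) (i : Fin N) :
    ∑ k, ‖(U : Matrix (Fin N) (Fin N) 𝕜) i k‖ ^ 2 = 1 := by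
  have h := congrFun (congrFun (Matrix.mem_unitaryGroup_iff.mp U.2) i) i
  rw [Matrix.mul_apply, Matrix.one_apply_eq] at h
  have h2 : ((∑ k, ‖(U : Matrix (Fin N) (Fin N) 𝕜) i k‖ ^ 2 : ℝ) : 𝕜) = 1 := by
    rw [← h]; push_cast
    refine Finset.sum_congr rfl fun k _ => ?_
    rw [Matrix.star_apply, RCLike.star_def, RCLike.mul_conj]
  exact_mod_cast h2

/-- Conjugating a diagonal matrix by a unitary does not change its spherical integral. -/
lemma sphericalIntegral_conj_diagonal [NeZero N] (θ : ℝ) (lam : Fin N → ℝ)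
    (V : Matrix.unitaryGroup (Fin N) 𝕜) :
    sphericalIntegral θ ((V : Matrix (Fin N) (Fin N) 𝕜) *
      Matrix.diagonal (fun k => (lam k : 𝕜)) * (V : Matrix (Fin N) (Fin N) 𝕜).conjTranspose) =
      diagIntegral 𝕜 θ lam := by
  rw [← integral_diagWeight_mul θ lam V, sphericalIntegral]
  congr 1; ext U
  rw [diagWeight]
  congr 2
  set W : Matrix (Fin N) (Fin N) 𝕜 := ((U * V : Matrix.unitaryGroup (Fin N) 𝕜) :
    Matrix (Fin N) (Fin N) 𝕜) with hW
  have h : (U : Matrix (Fin N) (Fin N) 𝕜) * ((V : Matrix (Fin N) (Fin N) 𝕜) *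
      Matrix.diagonal (fun k => (lam k : 𝕜)) * (V : Matrix (Fin N) (Fin N) 𝕜).conjTranspose) *
      (U : Matrix (Fin N) (Fin N) 𝕜).conjTranspose =
      W * Matrix.diagonal (fun k => (lam k : 𝕜)) * W.conjTranspose := by
    have : W = (U : Matrix (Fin N) (Fin N) 𝕜) * (V : Matrix (Fin N) (Fin N) 𝕜) := rfl
    rw [this, Matrix.conjTranspose_mul]
    simp only [Matrix.mul_assoc]
  rw [h, Matrix.mul_apply, map_sum]
  refine Finset.sum_congr rfl fun k _ => ?_
  rw [Matrix.mul_diagonal, Matrix.conjTranspose_apply, RCLike.star_def, mul_right_comm,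
    RCLike.mul_conj, mul_comm]
  norm_cast

variable (𝕜) in
/-- A permutation matrix as a unitary. -/
def permUnitary (σ : Equiv.Perm (Fin N)) : Matrix.unitaryGroup (Fin N) 𝕜 :=
  ⟨σ.permMatrix 𝕜, by
    rw [Matrix.mem_unitaryGroup_iff, Matrix.star_eq_conjTranspose,
      Matrix.conjTranspose_permMatrix, ← Matrix.permMatrix_mul]
    simp⟩

lemma mul_permUnitary_apply (σ : Equiv.Perm (Fin N)) (U : Matrix.unitaryGroup (Fin N) 𝕜)
    (i k : Fin N) :
    ((U * permUnitary 𝕜 σ : Matrix.unitaryGroup (Fin N) 𝕜) : Matrix (Fin N) (Fin N) 𝕜) i (σ k) =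
      (U : Matrix (Fin N) (Fin N) 𝕜) i k := by
  change ((U : Matrix (Fin N) (Fin N) 𝕜) * σ.permMatrix 𝕜) i (σ k) = _
  rw [Equiv.Perm.permMatrix, PEquiv.mul_toMatrix_toPEquiv]
  simp

lemma diagWeight_mul_permUnitary [NeZero N] (θ : ℝ) (lam : Fin N → ℝ) (σ : Equiv.Perm (Fin N))
    (U : Matrix.unitaryGroup (Fin N) 𝕜) :
    diagWeight θ lam (U * permUnitary 𝕜 σ) = diagWeight θ (lam ∘ σ) U := by
  simp only [diagWeight]
  congr 2
  rw [← Equiv.sum_comp σ (fun k => lam k * _)]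
  simp only [mul_permUnitary_apply, Function.comp_apply]

/-- The integral is symmetric in the entries of the diagonal. -/
lemma diagIntegral_comp_perm [NeZero N] (θ : ℝ) (lam : Fin N → ℝ) (σ : Equiv.Perm (Fin N)) :
    diagIntegral 𝕜 θ (lam ∘ σ) = diagIntegral 𝕜 θ lam := by
  rw [← integral_diagWeight_mul θ lam (permUnitary 𝕜 σ), diagIntegral]
  simp only [diagWeight_mul_permUnitary]

/-- The spherical integral depends only on the ordered eigenvalues. -/
lemma sphericalIntegral_eq_diagIntegral [NeZero N] (θ : ℝ) {B : Matrix (Fin N) (Fin N) 𝕜}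
    (hB : B.IsHermitian) : sphericalIntegral θ B = diagIntegral 𝕜 θ (eig hB) := by
  have h1 : sphericalIntegral θ B = diagIntegral 𝕜 θ hB.eigenvalues := by
    rw [← sphericalIntegral_conj_diagonal θ hB.eigenvalues hB.eigenvectorUnitary]
    congr 1
    conv_lhs => rw [hB.spectral_theorem]
    rfl
  let e : Fin N ≃ Fin N :=
    (Fintype.equivOfCardEq (Fintype.card_fin _)).symm.trans (finCongr (Fintype.card_fin N))
  have h2 : hB.eigenvalues = eig hB ∘ e := by
    ext i
    simp [Matrix.IsHermitian.eigenvalues, eig, e]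
  rw [h1, h2, diagIntegral_comp_perm]

lemma eig_antitone {B : Matrix (Fin N) (Fin N) 𝕜} (hB : B.IsHermitian) : Antitone (eig hB) :=
  fun _ _ h => hB.eigenvalues₀_antitone (by simpa using h)

lemma abs_eig_le {B : Matrix (Fin N) (Fin N) 𝕜} (hB : B.IsHermitian) (i : Fin N) :
    |eig hB i| ≤ ‖Matrix.toEuclideanCLM (n := Fin N) (𝕜 := 𝕜) B‖ := by
  obtain ⟨j, hj⟩ : ∃ j, eig hB i = hB.eigenvalues j := by
    refine ⟨Fintype.equivOfCardEq (Fintype.card_fin _) (Fin.cast (Fintype.card_fin N).symm i), ?_⟩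
    simp [Matrix.IsHermitian.eigenvalues, eig]
  have h1 : Matrix.toEuclideanCLM (n := Fin N) (𝕜 := 𝕜) B (hB.eigenvectorBasis j) =
      hB.eigenvalues j • hB.eigenvectorBasis j := by
    have := hB.mulVec_eigenvectorBasis j
    apply (WithLp.equiv 2 _).injective
    exact this
  have h2 := (Matrix.toEuclideanCLM (n := Fin N) (𝕜 := 𝕜) B).le_opNorm (hB.eigenvectorBasis j)
  rw [h1, norm_smul, hB.eigenvectorBasis.norm_eq_one, mul_one, mul_one] at h2
  rwa [hj]

/-- Raising the diagonal by at most `δ` multiplies the integral by at most `exp (N θ δ)`. -/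
lemma diagIntegral_le_exp_mul [NeZero N] {θ δ : ℝ} (hθ : 0 ≤ θ) {lam mu : Fin N → ℝ}
    (h : ∀ k, lam k ≤ mu k + δ) :
    diagIntegral 𝕜 θ lam ≤ Real.exp (N * θ * δ) * diagIntegral 𝕜 θ mu := by
  rw [diagIntegral, diagIntegral, ← integral_const_mul]
  refine integral_mono (integrable_diagWeight θ lam) ((integrable_diagWeight θ mu).const_mul _)
    fun U => ?_
  simp only [diagWeight]
  rw [← Real.exp_add, ← mul_add]
  refine Real.exp_le_exp.mpr (mul_le_mul_of_nonneg_left ?_ (by positivity))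
  calc _ ≤ ∑ k, (mu k + δ) * ‖(U : Matrix (Fin N) (Fin N) 𝕜) 0 k‖ ^ 2 :=
        Finset.sum_le_sum fun k _ => mul_le_mul_of_nonneg_right (h k) (by positivity)
    _ = _ := by
        simp_rw [add_mul, Finset.sum_add_distrib, ← Finset.mul_sum, row_norm_sq_sum]
        ring

/-! ### Rotations in a coordinate plane -/

/-- The cosine `(1 + |t|²)^(-1/2)` of the rotation with tangent `t`. -/
noncomputable def rotCos (t : 𝕜) : ℝ := (Real.sqrt (1 + ‖t‖ ^ 2))⁻¹

lemma rotCos_sq (t : 𝕜) : rotCos t ^ 2 * (1 + ‖t‖ ^ 2) = 1 := by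
  have h : (0 : ℝ) < 1 + ‖t‖ ^ 2 := by positivity
  rw [rotCos, inv_pow, Real.sq_sqrt h.le, inv_mul_cancel₀ h.ne']

lemma rotCos_sq_le_one (t : 𝕜) : rotCos t ^ 2 ≤ 1 := by
  nlinarith [rotCos_sq t, mul_nonneg (sq_nonneg (rotCos t)) (sq_nonneg ‖t‖)]

lemma rotCos_mul_self (t : 𝕜) : (rotCos t : 𝕜) * rotCos t * (1 + t * star t) = 1 := by
  rw [RCLike.star_def, RCLike.mul_conj, ← sq]
  exact_mod_cast congrArg (RCLike.ofReal (K := 𝕜)) (rotCos_sq t)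

/-- The matrix of the Givens rotation with tangent `t` in the plane of the coordinates `0`, `i`. -/
noncomputable def givensMatrix [NeZero N] (i : Fin N) (t : 𝕜) : Matrix (Fin N) (Fin N) 𝕜 :=
  fun m l =>
    if l = 0 then (if m = 0 then (rotCos t : 𝕜) else if m = i then rotCos t * star t else 0)
    else if l = i then (if m = 0 then -(rotCos t * t) else if m = i then (rotCos t : 𝕜) else 0)
    else if m = l then 1 else 0

section Givens

variable [NeZero N] {i : Fin N} (hi : i ≠ 0) (t : 𝕜) (u : Fin N → 𝕜)
include hi

lemma sum_mul_givens_zero :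
    ∑ m, u m * givensMatrix i t m 0 = rotCos t * (u 0 + star t * u i) := by
  rw [Fintype.sum_eq_add 0 i hi.symm fun m hm => by simp [givensMatrix, hm.1, hm.2]]
  simp [givensMatrix, hi]; ring

lemma sum_mul_givens_self :
    ∑ m, u m * givensMatrix i t m i = rotCos t * (u i - t * u 0) := by
  rw [Fintype.sum_eq_add 0 i hi.symm fun m hm => by simp [givensMatrix, hm.1, hm.2]]
  simp [givensMatrix, hi]; ring

omit hi in
lemma sum_mul_givens_of_ne {l : Fin N} (h0 : l ≠ 0) (hl : l ≠ i) :
    ∑ m, u m * givensMatrix i t m l = u l := by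
  rw [Fintype.sum_eq_single l fun m hm => by simp [givensMatrix, h0, hl, hm]]
  simp [givensMatrix, h0, hl]

lemma givensMatrix_mem : givensMatrix i t ∈ Matrix.unitaryGroup (Fin N) 𝕜 := by
  have hc := rotCos_mul_self t
  rw [Matrix.mem_unitaryGroup_iff']
  ext k l
  rw [Matrix.mul_apply]
  simp only [Matrix.star_apply]
  by_cases hl0 : l = 0
  · subst hl0
    rw [sum_mul_givens_zero hi t (fun m => star (givensMatrix i t m k))]
    by_cases hk0 : k = 0
    · subst hk0
      simp [givensMatrix, hi] at hc ⊢; linear_combination hc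
    · by_cases hki : k = i
      · subst hki; simp [givensMatrix, hi]; right; ring
      · simp [givensMatrix, hk0, hki, Ne.symm hk0, Ne.symm hki]
  · by_cases hli : l = i
    · subst hli
      rw [sum_mul_givens_self hi t (fun m => star (givensMatrix l t m k))]
      by_cases hk0 : k = 0
      · subst hk0; simp [givensMatrix, hi, hi.symm]; right; ring
      · by_cases hki : k = l
        · subst hki; simp [givensMatrix, hi] at hc ⊢; linear_combination hc
        · simp [givensMatrix, hk0, hki, Ne.symm hk0, Ne.symm hki]
    · rw [sum_mul_givens_of_ne t (fun m => star (givensMatrix i t m k)) hl0 hli]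
      by_cases hk0 : k = 0
      · subst hk0; simp [givensMatrix, hl0, hli, Ne.symm hl0]
      · by_cases hki : k = i
        · subst hki; simp [givensMatrix, hi, hl0, hli, Ne.symm hli]
        · by_cases hkl : k = l
          · subst hkl; simp [givensMatrix, hk0, hki]
          · simp [givensMatrix, hk0, hki, hkl, Ne.symm hkl]

end Givens

/-- The Givens rotation with tangent `t` in the plane of the coordinates `0`, `i`. -/
noncomputable def givens [NeZero N] {i : Fin N} (hi : i ≠ 0) (t : 𝕜) :
    Matrix.unitaryGroup (Fin N) 𝕜 :=
  ⟨givensMatrix i t, givensMatrix_mem hi t⟩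

lemma norm_rotation_sq (a b t : 𝕜) :
    ‖(rotCos t : 𝕜) * (a + star t * b)‖ ^ 2 + ‖(rotCos t : 𝕜) * (b - t * a)‖ ^ 2 =
      ‖a‖ ^ 2 + ‖b‖ ^ 2 := by
  have hc := rotCos_mul_self t
  have : ((‖(rotCos t : 𝕜) * (a + star t * b)‖ ^ 2 + ‖(rotCos t : 𝕜) * (b - t * a)‖ ^ 2 : ℝ) : 𝕜)
      = ((‖a‖ ^ 2 + ‖b‖ ^ 2 : ℝ) : 𝕜) := by
    push_cast
    simp only [← RCLike.mul_conj, RCLike.star_def, map_mul, map_add, map_sub,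
      RCLike.conj_ofReal, RCLike.conj_conj] at hc ⊢
    linear_combination (a * (starRingEnd 𝕜) a + b * (starRingEnd 𝕜) b) * hc
  exact_mod_cast this

lemma sum_eq_add_add_erase {ι : Type*} [Fintype ι] [DecidableEq ι] {i j : ι} (h : i ≠ j)
    (f : ι → ℝ) :
    ∑ k, f k = f j + f i + ∑ k ∈ (Finset.univ.erase j).erase i, f k := by
  rw [← Finset.add_sum_erase _ _ (Finset.mem_univ j),
    ← Finset.add_sum_erase (Finset.univ.erase j) f (Finset.mem_erase.mpr ⟨h, Finset.mem_univ i⟩),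
    add_assoc]

/-- The energy with `lamᵢ` raised to `lam₀`, compared with the energy after a rotation of the
coordinates `0` and `i`. -/
lemma energy_update_eq [NeZero N] {i : Fin N} (hi : i ≠ 0) (t : 𝕜) (lam : Fin N → ℝ)
    (U : Matrix.unitaryGroup (Fin N) 𝕜) :
    ∑ k, Function.update lam i (lam 0) k * ‖(U : Matrix (Fin N) (Fin N) 𝕜) 0 k‖ ^ 2 =
      ∑ k, lam k * ‖((U * givens hi t : Matrix.unitaryGroup (Fin N) 𝕜) :
        Matrix (Fin N) (Fin N) 𝕜) 0 k‖ ^ 2 +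
      (lam 0 - lam i) * (rotCos t ^ 2 * ‖(U : Matrix (Fin N) (Fin N) 𝕜) 0 i -
        t * (U : Matrix (Fin N) (Fin N) 𝕜) 0 0‖ ^ 2) := by
  set u := (U : Matrix (Fin N) (Fin N) 𝕜) 0
  have hV : ∀ k, ((U * givens hi t : Matrix.unitaryGroup (Fin N) 𝕜) :
      Matrix (Fin N) (Fin N) 𝕜) 0 k = ∑ m, u m * givensMatrix i t m k := fun k => rfl
  simp only [hV]
  rw [sum_eq_add_add_erase hi, sum_eq_add_add_erase hi, sum_mul_givens_zero hi,
    sum_mul_givens_self hi, Function.update_self, Function.update_of_ne hi.symm]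
  have hrest : ∑ k ∈ (Finset.univ.erase 0).erase i,
      Function.update lam i (lam 0) k * ‖u k‖ ^ 2 =
      ∑ k ∈ (Finset.univ.erase 0).erase i, lam k * ‖∑ m, u m * givensMatrix i t m k‖ ^ 2 := by
    refine Finset.sum_congr rfl fun k hk => ?_
    have h1 := Finset.ne_of_mem_erase hk
    have h2 := Finset.ne_of_mem_erase (Finset.mem_of_mem_erase hk)
    rw [Function.update_of_ne h1, sum_mul_givens_of_ne t u h2 h1]
  rw [hrest]
  -- The rotation preserves the total mass of the two coordinates, and the raised energy weights all
  -- of it by `lam 0`. The energies therefore differ only through the mass left on coordinate `i`.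
  have h1 := norm_rotation_sq (u 0) (u i) t
  have h2 : ‖(rotCos t : 𝕜) * (u i - t * u 0)‖ ^ 2 = rotCos t ^ 2 * ‖u i - t * u 0‖ ^ 2 := by
    rw [norm_mul, mul_pow, RCLike.norm_ofReal, sq_abs]
  rw [← h2]
  linear_combination -(lam 0) * h1

/-! ### A finite grid of tangents -/

variable (𝕜) in
/-- A point of the grid of mesh `1 / n`. -/
noncomputable def gridPoint (n : ℕ) (p : ℤ × ℤ) : 𝕜 :=
  ((p.1 / n : ℝ) : 𝕜) + ((p.2 / n : ℝ) : 𝕜) * RCLike.I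

/-- The indices of the grid points that are needed to approximate the unit disc. -/
noncomputable def gridIndex (n : ℕ) : Finset (ℤ × ℤ) :=
  Finset.Icc (-(n : ℤ)) n ×ˢ Finset.Icc (-(n : ℤ)) n

lemma card_gridIndex (n : ℕ) : (gridIndex n).card = (2 * n + 1) ^ 2 := by
  rw [gridIndex, Finset.card_product, Int.card_Icc, ← sq]
  congr 1; omega

lemma exists_int_div_near {n : ℕ} (hn : 0 < n) {x : ℝ} (hx : |x| ≤ 1) :
    ∃ a ∈ Finset.Icc (-(n : ℤ)) n, |x - a / n| ≤ 1 / n := by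
  have hn' : (0 : ℝ) < n := by exact_mod_cast hn
  obtain ⟨h1, h2⟩ := abs_le.mp hx
  refine ⟨⌊x * n⌋, Finset.mem_Icc.mpr ⟨Int.le_floor.mpr ?_, ?_⟩, ?_⟩
  · push_cast; nlinarith
  · have : (⌊x * n⌋ : ℝ) ≤ n := (Int.floor_le _).trans (by nlinarith)
    exact_mod_cast this
  · have h3 := Int.floor_le (x * n)
    have h4 := Int.lt_floor_add_one (x * n)
    have : x - ⌊x * n⌋ / n = (x * n - ⌊x * n⌋) / n := by field_simp
    rw [this, abs_of_nonneg (div_nonneg (by linarith) hn'.le)]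
    exact div_le_div_of_nonneg_right (by linarith) hn'.le

/-- Real and imaginary parts are rounded separately. Over `ℝ` one has `RCLike.I = 0`, so grid points
are merely repeated, which does no harm to the count. -/
lemma exists_gridPoint_near {n : ℕ} (hn : 0 < n) {z : 𝕜} (hz : ‖z‖ ≤ 1) :
    ∃ p ∈ gridIndex n, ‖z - gridPoint 𝕜 n p‖ ≤ 2 / n := by
  obtain ⟨a, ha, ha'⟩ := exists_int_div_near hn ((RCLike.abs_re_le_norm z).trans hz)
  obtain ⟨b, hb, hb'⟩ := exists_int_div_near hn ((RCLike.abs_im_le_norm z).trans hz)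
  refine ⟨(a, b), Finset.mem_product.mpr ⟨ha, hb⟩, ?_⟩
  have h : z - gridPoint 𝕜 n (a, b) = ((RCLike.re z - a / n : ℝ) : 𝕜) +
      ((RCLike.im z - b / n : ℝ) : 𝕜) * RCLike.I := by
    conv_lhs => rw [← RCLike.re_add_im z]
    simp only [gridPoint]
    push_cast
    ring
  have hI : ‖(RCLike.I : 𝕜)‖ ≤ 1 := by
    rcases RCLike.I_eq_zero_or_im_I_eq_one (K := 𝕜) with h | h
    · simp [h]
    · exact (RCLike.norm_I_of_ne_zero (by rintro h0; simp [h0] at h)).le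
  rw [h]
  refine (norm_add_le _ _).trans ?_
  rw [norm_mul, RCLike.norm_ofReal, RCLike.norm_ofReal]
  have := mul_le_mul hb' hI (norm_nonneg _) (by positivity)
  calc _ ≤ 1 / (n : ℝ) + 1 / n * 1 := add_le_add ha' this
    _ = 2 / n := by ring

/-! ### Raising diagonal entries to the top value -/

section Raise

variable [NeZero N] {θ M : ℝ} (hθ : 0 ≤ θ) {lam : Fin N → ℝ} {i : Fin N} (hi : i ≠ 0)
  (hle : lam i ≤ lam 0) (hM : lam 0 - lam i ≤ 2 * M)
include hθ hle hM

/-- The tangent `U₀ᵢ / U₀₀` would empty the coordinate `i` exactly. The hypothesis on the norms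
keeps it in the unit disc, and a grid point at distance `2 / N` leaves a mass of at most `(2 / N)²`
there. -/
lemma diagWeight_update_le (U : Matrix.unitaryGroup (Fin N) 𝕜)
    (hU : ‖(U : Matrix (Fin N) (Fin N) 𝕜) 0 i‖ ≤ ‖(U : Matrix (Fin N) (Fin N) 𝕜) 0 0‖) :
    ∃ p ∈ gridIndex N, diagWeight θ (Function.update lam i (lam 0)) U ≤
      Real.exp (8 * M * θ) * diagWeight θ lam (U * givens hi (gridPoint 𝕜 N p)) := by
  have hN : 0 < N := NeZero.pos N
  have hN1 : (1 : ℝ) ≤ N := by exact_mod_cast hN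
  set a := (U : Matrix (Fin N) (Fin N) 𝕜) 0 0
  set b := (U : Matrix (Fin N) (Fin N) 𝕜) 0 i
  obtain ⟨p, hp, hz⟩ := exists_gridPoint_near (𝕜 := 𝕜) hN (z := b / a) (by
    rw [norm_div]; exact div_le_one_of_le₀ hU (norm_nonneg _))
  refine ⟨p, hp, ?_⟩
  set t := gridPoint 𝕜 N p
  -- If `a = 0`, the norm comparison forces `b = 0` as well.
  have hb : b = b / a * a := by
    by_cases ha : a = 0
    · rw [ha, norm_zero] at hU
      rw [ha, mul_zero, norm_le_zero_iff.mp hU]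
    · rw [div_mul_cancel₀ _ ha]
  have ha1 : ‖a‖ ≤ 1 := entry_norm_bound_of_unitary U.2 0 0
  have h1 : ‖b - t * a‖ ≤ 2 / N := by
    have : b - t * a = (b / a - t) * a := by rw [sub_mul, ← hb]
    rw [this, norm_mul]
    calc _ ≤ 2 / (N : ℝ) * 1 := mul_le_mul hz ha1 (norm_nonneg _) (by positivity)
      _ = _ := mul_one _
  have h2 : rotCos t ^ 2 * ‖b - t * a‖ ^ 2 ≤ (2 / N) ^ 2 :=
    calc _ ≤ 1 * (2 / (N : ℝ)) ^ 2 := mul_le_mul (rotCos_sq_le_one t)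
          (pow_le_pow_left₀ (norm_nonneg _) h1 2) (by positivity) zero_le_one
      _ = _ := one_mul _
  have hM0 : 0 ≤ M := by linarith
  simp only [diagWeight]
  rw [energy_update_eq hi t, ← Real.exp_add, mul_add, add_comm]
  refine Real.exp_le_exp.mpr (add_le_add_left ?_ _)
  calc (N : ℝ) * θ * ((lam 0 - lam i) * (rotCos t ^ 2 * ‖b - t * a‖ ^ 2))
      ≤ N * θ * ((2 * M) * (2 / N) ^ 2) := by
        refine mul_le_mul_of_nonneg_left (mul_le_mul hM h2 (by positivity) (by linarith))
          (by positivity)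
    _ = 8 * M * θ / N := by field_simp; ring
    _ ≤ 8 * M * θ := div_le_self (by positivity) hN1

/-- Raising one entry of the diagonal to the value of the entry `0` costs a polynomial factor. -/
lemma diagIntegral_update_le (hi : i ≠ 0) :
    diagIntegral 𝕜 θ (Function.update lam i (lam 0)) ≤
      2 * (2 * N + 1) ^ 2 * Real.exp (8 * M * θ) * diagIntegral 𝕜 θ lam := by
  set mu := Function.update lam i (lam 0) with hmu
  set P := permUnitary 𝕜 (Equiv.swap 0 i)
  set G : ℤ × ℤ → Matrix.unitaryGroup (Fin N) 𝕜 := fun p => givens hi (gridPoint 𝕜 N p)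
  have hsymm : mu ∘ Equiv.swap 0 i = mu := by
    ext k
    rw [Function.comp_apply]
    rcases eq_or_ne k 0 with rfl | h0
    · simp [hmu, hi.symm]
    rcases eq_or_ne k i with rfl | h1
    · simp [hmu, hi.symm]
    · rw [Equiv.swap_apply_of_ne_of_ne h0 h1]
  -- The good grid point depends on `U`; summing over all of them gives a bound whose terms can be
  -- integrated by invariance.
  have hpt : ∀ U : Matrix.unitaryGroup (Fin N) 𝕜, diagWeight θ mu U ≤
      Real.exp (8 * M * θ) * ∑ p ∈ gridIndex N,
        (diagWeight θ lam (U * G p) + diagWeight θ lam (U * (P * G p))) := by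
    have hpos : ∀ V : Matrix.unitaryGroup (Fin N) 𝕜, 0 ≤ diagWeight θ lam V :=
      fun V => (Real.exp_pos _).le
    intro U
    rcases le_total ‖(U : Matrix (Fin N) (Fin N) 𝕜) 0 i‖ ‖(U : Matrix (Fin N) (Fin N) 𝕜) 0 0‖
      with h | h
    · obtain ⟨p, hp, hle'⟩ := diagWeight_update_le hθ hi hle hM U h
      refine hle'.trans (mul_le_mul_of_nonneg_left ?_ (Real.exp_pos _).le)
      exact (le_add_of_nonneg_right (hpos _)).trans
        (Finset.single_le_sum (f := fun p => diagWeight θ lam (U * G p) +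
          diagWeight θ lam (U * (P * G p))) (fun p _ => add_nonneg (hpos _) (hpos _)) hp)
    -- Here the tangent would leave the unit disc, so the two coordinates are swapped first; `mu`
    -- agrees at both and does not notice.
    · have e1 : ((U * P : Matrix.unitaryGroup (Fin N) 𝕜) : Matrix (Fin N) (Fin N) 𝕜) 0 i =
          (U : Matrix (Fin N) (Fin N) 𝕜) 0 0 := by
        simpa using mul_permUnitary_apply (𝕜 := 𝕜) (Equiv.swap 0 i) U 0 0
      have e2 : ((U * P : Matrix.unitaryGroup (Fin N) 𝕜) : Matrix (Fin N) (Fin N) 𝕜) 0 0 =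
          (U : Matrix (Fin N) (Fin N) 𝕜) 0 i := by
        simpa using mul_permUnitary_apply (𝕜 := 𝕜) (Equiv.swap 0 i) U 0 i
      obtain ⟨p, hp, hle'⟩ := diagWeight_update_le hθ hi hle hM (U * P) (by rw [e1, e2]; exact h)
      rw [diagWeight_mul_permUnitary, hsymm, mul_assoc U] at hle'
      refine hle'.trans (mul_le_mul_of_nonneg_left ?_ (Real.exp_pos _).le)
      exact (le_add_of_nonneg_left (hpos _)).trans
        (Finset.single_le_sum (f := fun p => diagWeight θ lam (U * G p) +
          diagWeight θ lam (U * (P * G p))) (fun p _ => add_nonneg (hpos _) (hpos _)) hp)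
  have hint : ∀ p ∈ gridIndex N, Integrable (fun U => diagWeight θ lam (U * G p) +
      diagWeight θ lam (U * (P * G p))) (haarProb 𝕜 N) := fun p _ =>
    (integrable_diagWeight_mul θ lam _).add (integrable_diagWeight_mul θ lam _)
  calc diagIntegral 𝕜 θ mu ≤ ∫ U, Real.exp (8 * M * θ) * ∑ p ∈ gridIndex N,
        (diagWeight θ lam (U * G p) + diagWeight θ lam (U * (P * G p))) ∂(haarProb 𝕜 N) :=
        integral_mono (integrable_diagWeight θ mu)
          ((integrable_finsetSum _ hint).const_mul _) hpt
    _ = Real.exp (8 * M * θ) * ∑ p ∈ gridIndex N, (2 * diagIntegral 𝕜 θ lam) := by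
        rw [integral_const_mul, integral_finsetSum _ hint]
        congr 1
        refine Finset.sum_congr rfl fun p _ => ?_
        rw [integral_add (integrable_diagWeight_mul θ lam _) (integrable_diagWeight_mul θ lam _),
          integral_diagWeight_mul, integral_diagWeight_mul, two_mul]
    _ = _ := by
        rw [Finset.sum_const, card_gridIndex, nsmul_eq_mul]
        push_cast; ring

end Raise

/-- Raising the entries of the diagonal with index in `S` to the value of the entry `0`. -/
lemma diagIntegral_raise_le [NeZero N] {θ M : ℝ} (hθ : 0 ≤ θ) {lam : Fin N → ℝ}
    (hle : ∀ k, lam k ≤ lam 0) (hM : ∀ k, lam 0 - lam k ≤ 2 * M) (S : Finset (Fin N)) (hS : 0 ∉ S) :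
    diagIntegral 𝕜 θ (fun k => if k ∈ S then lam 0 else lam k) ≤
      (2 * (2 * N + 1) ^ 2 * Real.exp (8 * M * θ)) ^ S.card * diagIntegral 𝕜 θ lam := by
  induction S using Finset.induction_on with
  | empty => simp
  | insert a S ha ih =>
    have h0 : (0 : Fin N) ∉ S := fun h => hS (Finset.mem_insert_of_mem h)
    have ha0 : a ≠ 0 := fun h => hS (h ▸ Finset.mem_insert_self a S)
    set mu : Fin N → ℝ := fun k => if k ∈ S then lam 0 else lam k with hmu
    -- Since `0 ∉ S`, the entry `0` never moves, so each step raises to the same value.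
    have hmu0 : mu 0 = lam 0 := by simp [hmu]
    have hmua : mu a = lam a := by simp [hmu, ha]
    have h1 : (fun k => if k ∈ insert a S then lam 0 else lam k) =
        Function.update mu a (mu 0) := by
      ext k
      rcases eq_or_ne k a with rfl | hk
      · simp [hmu0]
      · simp [hmu, hk]
    rw [h1, Finset.card_insert_of_notMem ha, pow_succ', mul_assoc]
    refine (diagIntegral_update_le (M := M) hθ (by rw [hmu0, hmua]; exact hle a)
      (by rw [hmu0, hmua]; exact hM a) ha0).trans ?_
    exact mul_le_mul_of_nonneg_left (ih h0) (by positivity)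

/-! ### Dudley distance and ordered eigenvalues -/

/-- For two sequences ordered in the same way there is a function with Lipschitz constant one that
realizes the `ℓ¹` distance of the sequences. -/
lemma exists_lipschitz_sub_eq_abs {ι : Type*} [LinearOrder ι] [Finite ι] {a b : ι → ℝ}
    (ha : Antitone a) (hb : Antitone b) :
    ∃ F : ℝ → ℝ, F 0 = 0 ∧ LipschitzWith 1 F ∧ ∀ i, F (a i) - F (b i) = |a i - b i| := by
  classical
  -- `F` is a primitive of a sign: `+1` where some `a j` lies above `b j`, and `-1` elsewhere.
  set E : Set ℝ := ⋃ j, Set.Ico (b j) (a j) with hE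
  have hEm : MeasurableSet E := MeasurableSet.iUnion fun j => measurableSet_Ico
  set s : ℝ → ℝ := fun t => if t ∈ E then 1 else -1 with hs
  have hsm : Measurable s := Measurable.ite hEm measurable_const measurable_const
  have hs1 : ∀ t, ‖s t‖ ≤ 1 := fun t => by
    simp only [hs]; split_ifs <;> simp
  have hint : ∀ x y, IntervalIntegrable s volume x y := fun x y =>
    (intervalIntegrable_const (c := (1 : ℝ))).mono_fun hsm.aestronglyMeasurable
      (Eventually.of_forall fun t => by simpa using hs1 t)
  refine ⟨fun x => ∫ t in (0 : ℝ)..x, s t, by simp, ?_, fun i => ?_⟩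
  · refine LipschitzWith.of_dist_le_mul fun x y => ?_
    rw [Real.dist_eq, Real.dist_eq, intervalIntegral.integral_interval_sub_left (hint _ _)
      (hint _ _)]
    simpa using intervalIntegral.norm_integral_le_of_norm_le_const fun t _ => hs1 t
  · simp only
    rw [intervalIntegral.integral_interval_sub_left (hint _ _) (hint _ _)]
    rcases le_total (b i) (a i) with h | h
    · rw [intervalIntegral.integral_congr_Ioo_of_le (g := fun _ => (1 : ℝ)) h
          fun t (ht : t ∈ Set.Ioo _ _) => ?_]
      · simp [abs_of_nonneg (sub_nonneg.mpr h)]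
      · have hmem : t ∈ E := Set.mem_iUnion.mpr ⟨i, ht.1.le, ht.2⟩
        exact if_pos hmem
    · rw [intervalIntegral.integral_symm,
        intervalIntegral.integral_congr_Ioo_of_le (g := fun _ => (-1 : ℝ)) h
          fun t (ht : t ∈ Set.Ioo _ _) => ?_]
      · simp [abs_of_nonpos (sub_nonpos.mpr h)]
      -- The common ordering keeps an interval with `a i < b i` disjoint from every `[b k, a k)`: an
      -- overlap gives `k < i` through `a`, hence `b i ≤ b k`, a contradiction.
      · refine if_neg fun (hmem : t ∈ E) => ?_
        obtain ⟨k, hk1, hk2⟩ := Set.mem_iUnion.mp hmem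
        have h1 : k < i := lt_of_not_ge fun hik => by linarith [ha hik, ht.1]
        linarith [hb h1.le, ht.2]

lemma integral_truncSpectralMeasure [NeZero N] {B : Matrix (Fin N) (Fin N) 𝕜} (hB : B.IsHermitian)
    (f : ℝ → ℝ) :
    ∫ x, f x ∂(truncSpectralMeasure hB) =
      (N : ℝ)⁻¹ * ∑ i ∈ Finset.univ.erase (0 : Fin N), f (eig hB i) := by
  rw [truncSpectralMeasure, integral_smul_measure, integral_finsetSum_measure]
  · simp
  · intro i _
    exact integrable_dirac (by simp)

/-- The `ℓ¹` distance of the ordered eigenvalues is controlled by the Dudley distance. -/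
lemma sum_abs_eig_sub_le [NeZero N] {B B' : Matrix (Fin N) (Fin N) 𝕜} (hB : B.IsHermitian)
    (hB' : B'.IsHermitian) {R ε : ℝ} (hR : 1 ≤ R) (hε : 0 ≤ ε)
    (h1 : ∀ i, |eig hB i| ≤ R) (h2 : ∀ i, |eig hB' i| ≤ R)
    (hd : dudleyDist (truncSpectralMeasure hB) (truncSpectralMeasure hB') ≤ ENNReal.ofReal ε) :
    ∑ i ∈ Finset.univ.erase (0 : Fin N), |eig hB i - eig hB' i| ≤ N * (R * ε) := by
  have hN : (0 : ℝ) < N := by exact_mod_cast NeZero.pos N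
  have hR0 : 0 < R := by linarith
  obtain ⟨F, hF0, hFL, hF⟩ := exists_lipschitz_sub_eq_abs (eig_antitone hB) (eig_antitone hB')
  -- Truncation at `±R` and division by `R ≥ 1` make `F` an admissible test function; the truncation
  -- does nothing on the eigenvalues.
  set c : ℝ → ℝ := fun x => max (-R) (min R x) with hc
  have hcL : LipschitzWith 1 c := (LipschitzWith.id.const_min R).const_max (-R)
  have hc_abs : ∀ x, |c x| ≤ R := fun x =>
    abs_le.mpr ⟨le_max_left _ _, max_le (by linarith) (min_le_left _ _)⟩
  have hc_eq : ∀ x, |x| ≤ R → c x = x := fun x hx => by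
    obtain ⟨h3, h4⟩ := abs_le.mp hx
    simp only [hc]; rw [min_eq_right h4, max_eq_right h3]
  set f : ℝ → ℝ := fun x => R⁻¹ * F (c x) with hf
  have hFc : ∀ x y, |F x - F y| ≤ |x - y| := fun x y => by
    simpa [Real.dist_eq] using hFL.dist_le_mul x y
  have hcc : ∀ x y, |c x - c y| ≤ |x - y| := fun x y => by
    simpa [Real.dist_eq] using hcL.dist_le_mul x y
  have hfL : LipschitzWith 1 f := LipschitzWith.of_dist_le_mul fun x y => by
    rw [Real.dist_eq, Real.dist_eq, NNReal.coe_one, one_mul]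
    simp only [hf]
    rw [← mul_sub, abs_mul, abs_of_pos (inv_pos.mpr hR0)]
    calc _ ≤ 1 * |x - y| := mul_le_mul (inv_le_one_of_one_le₀ hR) ((hFc _ _).trans (hcc _ _))
          (abs_nonneg _) zero_le_one
      _ = _ := one_mul _
  have hf1 : ∀ x, |f x| ≤ 1 := fun x => by
    simp only [hf]
    rw [abs_mul, abs_of_pos (inv_pos.mpr hR0), inv_mul_le_iff₀ hR0, mul_one]
    have := hFc (c x) 0
    rw [hF0, sub_zero, sub_zero] at this
    exact this.trans (hc_abs x)
  have hle : ENNReal.ofReal |∫ x, f x ∂(truncSpectralMeasure hB) -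
      ∫ x, f x ∂(truncSpectralMeasure hB')| ≤ ENNReal.ofReal ε :=
    (le_iSup₂ (f := fun (f : ℝ → ℝ) (_ : (∀ x, |f x| ≤ 1) ∧ LipschitzWith 1 f) =>
      ENNReal.ofReal |∫ x, f x ∂(truncSpectralMeasure hB) -
        ∫ x, f x ∂(truncSpectralMeasure hB')|) f ⟨hf1, hfL⟩).trans hd
  rw [ENNReal.ofReal_le_ofReal_iff hε, integral_truncSpectralMeasure hB,
    integral_truncSpectralMeasure hB', ← mul_sub,
    ← Finset.sum_sub_distrib] at hle
  have hterm : ∀ i, f (eig hB i) - f (eig hB' i) = R⁻¹ * |eig hB i - eig hB' i| := fun i => by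
    simp only [hf]
    rw [hc_eq _ (h1 i), hc_eq _ (h2 i), ← mul_sub, hF]
  simp only [hterm] at hle
  rw [← Finset.mul_sum] at hle
  have h3 := (le_abs_self _).trans hle
  rw [inv_mul_le_iff₀ hN, inv_mul_le_iff₀ hR0] at h3
  linarith

/-! ### Comparison of the integrals and the limit in `N` -/

/-- One-sided comparison of the spherical integrals. -/
lemma log_sphericalIntegral_le [NeZero N] {θ M δ ε R : ℝ} (hθ : 0 ≤ θ) (hδ : 0 < δ)
    {B B' : Matrix (Fin N) (Fin N) 𝕜} (hB : B.IsHermitian) (hB' : B'.IsHermitian)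
    (hM : ∀ i, |eig hB i| ≤ M) (h0 : eig hB' 0 ≤ eig hB 0 + δ)
    (hsum : ∑ i ∈ Finset.univ.erase (0 : Fin N), |eig hB i - eig hB' i| ≤ N * (R * ε)) :
    1 / (N : ℝ) * Real.log (sphericalIntegral θ B') -
      1 / (N : ℝ) * Real.log (sphericalIntegral θ B) ≤
      θ * δ + R * ε / δ * (Real.log (2 * (2 * N + 1) ^ 2) + 8 * M * θ) := by
  classical
  have hN : (0 : ℝ) < N := by exact_mod_cast NeZero.pos N
  have hM0 : 0 ≤ M := (abs_nonneg _).trans (hM 0)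
  set S : Finset (Fin N) := (Finset.univ.erase 0).filter fun i => δ < |eig hB i - eig hB' i|
    with hS
  -- Markov's inequality for the eigenvalue differences.
  have hcard : (S.card : ℝ) ≤ N * (R * ε / δ) := by
    have : (S.card : ℝ) * δ ≤ N * (R * ε) :=
      calc (S.card : ℝ) * δ = ∑ _i ∈ S, δ := by rw [Finset.sum_const, nsmul_eq_mul]
        _ ≤ ∑ i ∈ S, |eig hB i - eig hB' i| :=
          Finset.sum_le_sum fun i hi => (Finset.mem_filter.mp hi).2.le
        _ ≤ ∑ i ∈ Finset.univ.erase (0 : Fin N), |eig hB i - eig hB' i| :=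
          Finset.sum_le_sum_of_subset_of_nonneg (Finset.filter_subset _ _)
            fun _ _ _ => abs_nonneg _
        _ ≤ _ := hsum
    rw [mul_div_assoc', le_div_iff₀ hδ]; exact this
  have h1 : diagIntegral 𝕜 θ (eig hB') ≤ Real.exp (N * θ * δ) *
      diagIntegral 𝕜 θ (fun k => if k ∈ S then eig hB 0 else eig hB k) := by
    refine diagIntegral_le_exp_mul hθ fun k => ?_
    -- On `S` nothing is known about `eig hB' k` beyond its being at most the top eigenvalue, so the
    -- entry of `B` is raised to its own top, within `δ` of that one.
    by_cases hk : k ∈ S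
    · rw [if_pos hk]; exact (eig_antitone hB' (Fin.zero_le k)).trans h0
    · rw [if_neg hk]
      rcases eq_or_ne k 0 with rfl | hk0
      · exact h0
      · have : ¬ δ < |eig hB k - eig hB' k| := fun h =>
          hk (Finset.mem_filter.mpr ⟨Finset.mem_erase.mpr ⟨hk0, Finset.mem_univ k⟩, h⟩)
        linarith [(abs_le.mp (not_lt.mp this)).1]
  have h2 := diagIntegral_raise_le (𝕜 := 𝕜) (M := M) (lam := eig hB) hθ
    (fun k => eig_antitone hB (Fin.zero_le k))
    (fun k => by linarith [(abs_le.mp (hM k)).1, (abs_le.mp (hM 0)).2]) S (by simp [hS])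
  have h3 := h1.trans (mul_le_mul_of_nonneg_left h2 (Real.exp_pos _).le)
  have hJ := diagIntegral_pos (𝕜 := 𝕜) θ (eig hB)
  have h4 := Real.log_le_log (diagIntegral_pos θ (eig hB')) h3
  have hL : 0 ≤ Real.log (2 * (2 * N + 1) ^ 2) := by
    refine Real.log_nonneg ?_
    nlinarith
  rw [Real.log_mul (Real.exp_pos _).ne' (by positivity), Real.log_mul (by positivity) hJ.ne',
    Real.log_exp, Real.log_pow, Real.log_mul (by positivity) (Real.exp_pos _).ne',
    Real.log_exp] at h4
  rw [sphericalIntegral_eq_diagIntegral θ hB, sphericalIntegral_eq_diagIntegral θ hB', ← mul_sub,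
    one_div, inv_mul_le_iff₀ hN]
  have h5 := mul_le_mul_of_nonneg_right hcard
    (add_nonneg hL (by positivity : 0 ≤ 8 * M * θ))
  linarith

lemma tendsto_rpow_neg_mul_log {κ : ℝ} (hκ : 0 < κ) (C D : ℝ) :
    Tendsto (fun N : ℕ => C * (N : ℝ) ^ (-κ) * (Real.log (2 * (2 * N + 1) ^ 2) + D))
      atTop (𝓝 0) := by
  have hp : Tendsto (fun x : ℝ => x ^ (-κ)) atTop (𝓝 0) := tendsto_rpow_neg_atTop hκ
  have hlog : Tendsto (fun x : ℝ => x ^ (-κ) * Real.log x) atTop (𝓝 0) := by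
    refine (isLittleO_log_rpow_atTop hκ).tendsto_div_nhds_zero.congr' ?_
    filter_upwards [eventually_gt_atTop 0] with x hx
    rw [Real.rpow_neg hx.le, div_eq_mul_inv, mul_comm]
  have hmaj : Tendsto (fun x : ℝ => |C| * (x ^ (-κ) * (Real.log 18 + |D|) +
      2 * (x ^ (-κ) * Real.log x))) atTop (𝓝 0) := by
    simpa using ((hp.mul_const (Real.log 18 + |D|)).add (hlog.const_mul 2)).const_mul |C|
  refine squeeze_zero_norm' ?_ (hmaj.comp tendsto_natCast_atTop_atTop)
  filter_upwards [eventually_ge_atTop 1] with N hN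
  have hN1 : (1 : ℝ) ≤ N := by exact_mod_cast hN
  have hpos : (0 : ℝ) ≤ (N : ℝ) ^ (-κ) := by positivity
  -- The `18` comes from `2 (2N + 1)² ≤ 2 (3N)²` for `N ≥ 1`.
  have hl : |Real.log (2 * (2 * N + 1) ^ 2) + D| ≤ Real.log 18 + 2 * Real.log N + |D| := by
    refine (abs_add_le _ _).trans (add_le_add_left ?_ _)
    rw [abs_of_nonneg (Real.log_nonneg (by nlinarith))]
    have : Real.log 18 + 2 * Real.log N = Real.log (18 * (N : ℝ) ^ 2) := by
      rw [Real.log_mul (by norm_num) (by positivity), Real.log_pow]; norm_num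
    rw [this]
    exact Real.log_le_log (by positivity) (by nlinarith)
  rw [Real.norm_eq_abs, abs_mul, abs_mul, abs_of_nonneg hpos, mul_assoc, Function.comp_apply]
  refine mul_le_mul_of_nonneg_left ?_ (abs_nonneg C)
  calc _ ≤ (N : ℝ) ^ (-κ) * (Real.log 18 + 2 * Real.log N + |D|) :=
        mul_le_mul_of_nonneg_left hl hpos
    _ = _ := by ring

end RankOneSpherical

theorem proposition1 {𝕜 : Type*} [RCLike 𝕜] (θ : ℝ) (hθ : 0 < θ)
    (κ : ℝ) (hκ : κ ∈ Set.Ioo (0 : ℝ) (1 / 2)) :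
    ∃ g : ℝ≥0 → ℝ≥0, Tendsto g (𝓝 0) (𝓝 0) ∧
      ∀ M : ℝ, ∀ δ : ℝ≥0, 0 < δ → ∃ N₀ : ℕ, ∀ N : ℕ, N₀ ≤ N → ∀ [NeZero N],
        ∀ (B B' : Matrix (Fin N) (Fin N) 𝕜) (hB : B.IsHermitian) (hB' : B'.IsHermitian),
          ‖Matrix.toEuclideanCLM (n := Fin N) (𝕜 := 𝕜) B‖ ≤ M →
          ‖Matrix.toEuclideanCLM (n := Fin N) (𝕜 := 𝕜) B'‖ ≤ M →
          RankOneSpherical.dudleyDist (RankOneSpherical.truncSpectralMeasure hB)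
            (RankOneSpherical.truncSpectralMeasure hB') ≤ ENNReal.ofReal ((N : ℝ) ^ (-κ)) →
          |RankOneSpherical.eig hB 0 - RankOneSpherical.eig hB' 0| ≤ δ →
          |1 / (N : ℝ) * Real.log (RankOneSpherical.sphericalIntegral θ B) -
            1 / (N : ℝ) * Real.log (RankOneSpherical.sphericalIntegral θ B')| ≤ g δ := by
  -- The part `θ δ` pays for the uniform shift; the extra `δ` absorbs the cost of raising once `N`
  -- is large.
  refine ⟨fun δ => (θ.toNNReal + 1) * δ, ?_, fun M δ hδ => ?_⟩
  · have h : Continuous fun δ : ℝ≥0 => (θ.toNNReal + 1) * δ := by fun_prop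
    simpa using h.tendsto 0
  have hδ' : (0 : ℝ) < δ := hδ
  obtain ⟨N₀, hN₀⟩ := eventually_atTop.mp
    ((RankOneSpherical.tendsto_rpow_neg_mul_log hκ.1 (max 1 M / δ) (8 * M * θ)).eventually_le_const
      hδ')
  refine ⟨N₀, fun N hN _ B B' hB hB' hBM hBM' hd h0 => ?_⟩
  have h1 : ∀ i, |RankOneSpherical.eig hB i| ≤ M :=
    fun i => (RankOneSpherical.abs_eig_le hB i).trans hBM
  have h1' : ∀ i, |RankOneSpherical.eig hB' i| ≤ M :=
    fun i => (RankOneSpherical.abs_eig_le hB' i).trans hBM'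
  have hsum := RankOneSpherical.sum_abs_eig_sub_le hB hB' (le_max_left 1 M)
    (by positivity) (fun i => (h1 i).trans (le_max_right 1 M))
    (fun i => (h1' i).trans (le_max_right 1 M)) hd
  have hsum' := hsum
  simp only [abs_sub_comm (RankOneSpherical.eig hB _)] at hsum'
  obtain ⟨h2, h3⟩ := abs_le.mp h0
  have hA := RankOneSpherical.log_sphericalIntegral_le hθ.le hδ' hB hB' h1 (by linarith) hsum
  have hA' := RankOneSpherical.log_sphericalIntegral_le hθ.le hδ' hB' hB h1' (by linarith) hsum'
  have hE := hN₀ N hN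
  rw [← mul_div_right_comm] at hE
  push_cast
  rw [Real.coe_toNNReal _ hθ.le, abs_le]
  constructor <;> linarith
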